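/- Consider the linear model of a Buck converter with component values $p=(R_L,C,R_c,L,R_i,R_{\rm ON},k_{\rm FF})$, all positive. With $R_i'=R_i+R_{\rm ON}$ and $D(s)=CL(R_L+R_c)s^2+\bigl(L+CR_L(R_c+R_i')+CR_cR_i'\bigr)s+R_L+R_i'$ put $$P_{11}=P_{22}=\frac{R_L(1+CR_cs)}{D(s)},\quad P_{12}=-\frac{R_L(1+CR_cs)(Ls+R_i')}{D(s)},\quad P_{21}=\frac{C(R_L+R_c)s+1}{D(s)},\quad G_1=\frac{P_{21}}{P_{11}},\quad G_2=\frac{P_{12}}{P_{11}}.$$ The plant with input voltage $v_{\rm SW}$, load current disturbance $\tilde i_{\rm out}$, output voltage $v_o$ and inductor current $i_L$ is $v_o=P_{11}v_{\rm SW}+P_{12}\tilde i_{\rm out}$, $i_L=P_{21}v_{\rm SW}+P_{22}\tilde i_{\rm out}$. The actual component values range over a set $U$; a hat denotes a quantity computed with fixed nominal component values, and its absence one computed with the actual values. For a real rational $G$ let $\|G\|_{\mathcal H_\infty}=\sup_{\omega\in\mathbb R}|G(i\omega)|$. An interconnection of transfer functions is called (internally) stable if all transfer functions from signals injected additively at its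 nodes to its signals are well defined, proper and have all their poles in the open left half-plane. Theorem 2. Let $\mathcal K$ (controller) and $G_f$ (feedback gain) be real rational transfer functions such that $\mathcal K$ robustly stabilizes the uncertain plant $P_{11}k_{\rm FF}$, i.e. the loop $v_o=P_{11}k_{\rm FF}v_c$, $v_c=\mathcal K e$, $e=r-G_fv_o$ is stable for all component values in $U$, and let $S=(1+P_{11}k_{\rm FF}\mathcal K G_f)^{-1}$ be its sensitivity function. Let $\Lambda$ be a real rational weight such that for all component values in $U$ one has $G_1=\hat G_1+\Lambda\Delta_1$ for some real rational $\Delta_1$ with $\|\Delta_1\|_{\mathcal H_\infty}<1$. Let $p_H>0$ and $W_r=\dfrac{\hat G_2\,\Lambda}{\hat k_{\rm FF}(1+s/p_H)}$. If $$\|S P_{11}k_{\rm FF}W_r\|_{\mathcal H_\infty}<1\quad\text{for all component values in }U,$$ then robust stability is preserved after insertion of the load estimator-compensator (LEC) $$v_{\rm inj}=\frac{-\hat G_2}{\hat k_{\rm FF}(1+s/p_H)}\,\bigl(-\hat G_1v_o+i_L\bigr)$$ with nominal parameters: for all component values in $U$, the interconnection of the plant, $v_{\rm SW}=k_{\rm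 FF}(v_c+v_{\rm inj})$, the LEC, $v_c=\mathcal K e$ and $e=r-G_fv_o$ is stable. -/

import Mathlib

open scoped ENNReal

namespace BuckLEC

noncomputable section

/-! Transfer functions are real rational functions; the Laplace variable is `RatFunc.X`. -/

/-- The frequency response `G(iω)` of a real rational transfer function. -/
def freqResp (G : RatFunc ℝ) (ω : ℝ) : ℂ :=
  G.eval (algebraMap ℝ ℂ) (Complex.I * (ω : ℂ))

/-- The H-infinity norm `sup_{ω ∈ ℝ} |G(iω)|` of a scalar transfer function, with value in
`[0, ∞]`. A pole of `G` on the imaginary axis forces the value `∞`, since `|G(iω)|` is unbounded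
near it, and so does an improper `G`. -/
def hinfNorm (G : RatFunc ℝ) : ℝ≥0∞ :=
  ⨆ ω : ℝ, ‖freqResp G ω‖ₑ

/-- `G` is proper and all its poles lie in the open left half-plane. -/
def IsStableProper (G : RatFunc ℝ) : Prop :=
  G.intDegree ≤ 0 ∧ ∀ z : ℂ, Polynomial.aeval z G.denom = 0 → z.re < 0

/-- Internal stability of an interconnection of transfer-function blocks. The loop equations are
`w = M w + d`, where `w` collects all signals of the loop and `d` collects external signals, one
injected at every node. The interconnection is internally stable if it is solvable and every
transfer function from an injected signal to a signal of the loop is proper and stable. -/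
def InternallyStable {n : ℕ} (M : Matrix (Fin n) (Fin n) (RatFunc ℝ)) : Prop :=
  IsUnit (1 - M) ∧ ∀ i j, IsStableProper ((1 - M)⁻¹ i j)

/-- Physical parameters of the converter: load resistance `RL`, output capacitance `Cap` and its
series resistance `Rc`, inductance `L` and its series resistance `Ri`, on-resistance `Ron` of the
switches, feed-forward gain `kFF`. -/
structure Params where
  RL : ℝ
  Cap : ℝ
  Rc : ℝ
  L : ℝ
  Ri : ℝ
  Ron : ℝ
  kFF : ℝ
  RL_pos : 0 < RL
  Cap_pos : 0 < Cap
  Rc_pos : 0 < Rc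
  L_pos : 0 < L
  Ri_pos : 0 < Ri
  Ron_pos : 0 < Ron
  kFF_pos : 0 < kFF

namespace Params

variable (p : Params)

/-- `R_i' = R_i + R_ON`. -/
def Ri' : ℝ := p.Ri + p.Ron

def α₀ : ℝ := p.Cap * p.L * (p.RL + p.Rc)

def α₁ : ℝ := p.L + p.Cap * p.RL * (p.Rc + p.Ri') + p.Cap * p.Rc * p.Ri'

def α₂ : ℝ := p.RL + p.Ri'

/-- The common denominator `α₀ s² + α₁ s + α₂` of the power stage. -/
def den : RatFunc ℝ :=
  RatFunc.C p.α₀ * RatFunc.X ^ 2 + RatFunc.C p.α₁ * RatFunc.X + RatFunc.C p.α₂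

/-- Transfer function from the switching-node voltage to the output voltage. -/
def P11 : RatFunc ℝ :=
  RatFunc.C p.RL * (1 + RatFunc.C (p.Cap * p.Rc) * RatFunc.X) / p.den

/-- Transfer function from the load current disturbance to the output voltage. -/
def P12 : RatFunc ℝ :=
  RatFunc.C p.RL *
    (-(RatFunc.C (p.Cap * p.L * p.Rc) * RatFunc.X ^ 2)
      - RatFunc.C (p.L + p.Cap * p.Rc * p.Ri') * RatFunc.X - RatFunc.C p.Ri') / p.den

/-- Transfer function from the switching-node voltage to the inductor current. -/
def P21 : RatFunc ℝ :=
  (RatFunc.C (p.Cap * (p.RL + p.Rc)) * RatFunc.X + 1) / p.den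

/-- Transfer function from the load current disturbance to the inductor current. -/
def P22 : RatFunc ℝ := p.P11

/-- The transfer function `k_FF` of the modulator and half bridge (a static gain). -/
def k : RatFunc ℝ := RatFunc.C p.kFF

def G1 : RatFunc ℝ := p.P21 / p.P11

def G2 : RatFunc ℝ := p.P12 / p.P11

/-- The compensation filter `F = -G₂ / (k_FF (1 + s / p_H))` built from the parameters `p`. -/
def compensator (pH : ℝ) : RatFunc ℝ :=
  -p.G2 / (p.k * (1 + RatFunc.X / RatFunc.C pH))

end Params

/-- The outer voltage loop without compensation, with signals `(v_o, v_c, e)`: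
`v_o = P₁₁ k_FF v_c`, `v_c = K e`, `e = -G_f v_o`
(the reference is the external signal injected at `e`). -/
def outerLoop (p : Params) (K Gf : RatFunc ℝ) : Matrix (Fin 3) (Fin 3) (RatFunc ℝ) :=
  !![0, p.P11 * p.k, 0;
     0, 0, K;
     -Gf, 0, 0]

/-- The complete loop with the load estimator-compensator. The plant has the actual parameters
`p`, the estimator-compensator has the nominal parameters `pnom`. The signals are
`(i_out, v_SW, v_o, i_L, i_est, v_inj, v_c, e)` and the loop equations are
`v_SW = k_FF (v_inj + v_c)`, `v_o = P₁₂ i_out + P₁₁ v_SW`, `i_L = P₂₂ i_out + P₂₁ v_SW`,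
`i_est = -Ĝ₁ v_o + i_L`, `v_inj = F̂ i_est`, `v_c = K e`, `e = -G_f v_o`
(the load current `i_out` is exogenous, hence the zero row; the reference is the external signal
injected at `e`). -/
def lecLoop (pnom : Params) (pH : ℝ) (p : Params) (K Gf : RatFunc ℝ) :
    Matrix (Fin 8) (Fin 8) (RatFunc ℝ) :=
  !![0,     0,     0,        0, 0,                   0,   0,   0;
     0,     0,     0,        0, 0,                   p.k, p.k, 0;
     p.P12, p.P11, 0,        0, 0,                   0,   0,   0;
     p.P22, p.P21, 0,        0, 0,                   0,   0,   0;
     0,     0,     -pnom.G1, 1, 0,                   0,   0,   0;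
     0,     0,     0,        0, pnom.compensator pH, 0,   0,   0;
     0,     0,     0,        0, 0,                   0,   0,   K;
     0,     0,     -Gf,      0, 0,                   0,   0,   0]

/-- `K` robustly stabilizes the uncertain plant `P₁₁ k_FF`, whose parameters range over `U`. -/
def RobustlyStabilizes (U : Set Params) (K Gf : RatFunc ℝ) : Prop :=
  ∀ p ∈ U, InternallyStable (outerLoop p K Gf)

/-- Robust stability of the loop that includes the load estimator-compensator. -/
def RobustlyStableWithLEC (U : Set Params) (pnom : Params) (pH : ℝ) (K Gf : RatFunc ℝ) : Prop :=
  ∀ p ∈ U, InternallyStable (lecLoop pnom pH p K Gf)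

/-- `Λ` is a weight for the additive uncertainty of `G₁` over `U`:
`G₁ = Ĝ₁ + Λ Δ₁` with `‖Δ₁‖ < 1` in the H-infinity norm. -/
def IsUncertaintyWeight (U : Set Params) (pnom : Params) (Λ : RatFunc ℝ) : Prop :=
  ∀ p ∈ U, ∃ Δ₁ : RatFunc ℝ, p.G1 = pnom.G1 + Λ * Δ₁ ∧ hinfNorm Δ₁ < 1

/-- The sensitivity function `S = (1 + P₁₁ k_FF K G_f)⁻¹` of the outer loop. -/
def sensitivity (p : Params) (K Gf : RatFunc ℝ) : RatFunc ℝ :=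
  (1 + p.P11 * p.k * K * Gf)⁻¹

/-- The weight `W_r = Ĝ₂ Λ / (k̂_FF (1 + s / p_H))` of the inverse multiplicative uncertainty. -/
def Wr (pnom : Params) (pH : ℝ) (Λ : RatFunc ℝ) : RatFunc ℝ :=
  pnom.G2 / (pnom.k * (1 + RatFunc.X / RatFunc.C pH)) * Λ

end

end BuckLEC

namespace BuckLEC

open Polynomial Filter Topology Asymptotics

/-! Since $P_{21}=G_1P_{11}$, the inductor current follows $v_o$ through the actual $G_1$, so the
LEC feeds back $\hat F(G_1-\hat G_1)v_o$ plus exogenous terms, with $\hat F$ the compensator. Closed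
through the outer loop this has loop gain $SP_{11}k_{\rm FF}\hat F\Lambda\Delta_1=-SP_{11}k_{\rm
FF}W_r\Delta_1$, of modulus at most some $c<1$ on the imaginary axis off finitely many points.

$\Lambda$ and $\Delta_1$ need not be stable, but $\Lambda\Delta_1=G_1-\hat G_1$ is, because $G_1$
and $\hat G_1$ are. Hence `small_gain` applies to the whole product and gives a stable inverse $Q$
of the return difference. In `lecLoop_internallyStable` every signal is then a polynomial in $Q$,
stable plant blocks and stable entries of the outer loop. -/

/-! ### The ring of proper stable transfer functions. -/

theorem isStableProper_of_mul_eq {f : RatFunc ℝ} {p q : ℝ[X]}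
    (h : f * algebraMap ℝ[X] (RatFunc ℝ) q = algebraMap ℝ[X] (RatFunc ℝ) p)
    (hq : ∀ z : ℂ, aeval z q = 0 → z.re < 0) (hdeg : p.natDegree ≤ q.natDegree) :
    IsStableProper f := by
  have hq0 : q ≠ 0 := by
    rintro rfl
    simpa using hq 0 (by simp)
  have hq0' : algebraMap ℝ[X] (RatFunc ℝ) q ≠ 0 := by simpa using hq0
  obtain rfl : f = algebraMap ℝ[X] (RatFunc ℝ) p / algebraMap ℝ[X] (RatFunc ℝ) q :=
    (eq_div_iff hq0').2 h
  refine ⟨?_, fun z hz => hq z ?_⟩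
  · by_cases hp : p = 0
    · simp [hp]
    rw [RatFunc.intDegree_div (by simpa using hp) hq0', RatFunc.intDegree_polynomial,
      RatFunc.intDegree_polynomial]
    omega
  · obtain ⟨r, hr⟩ := RatFunc.denom_div_dvd p q
    rw [hr, map_mul, hz, zero_mul]

theorem IsStableProper.natDegree_num_le {f : RatFunc ℝ} (hf : IsStableProper f) :
    f.num.natDegree ≤ f.denom.natDegree := by
  have := hf.1
  rw [RatFunc.intDegree] at this
  omega

theorem IsStableProper.add {f g : RatFunc ℝ} (hf : IsStableProper f) (hg : IsStableProper g) :
    IsStableProper (f + g) := by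
  refine ⟨?_, fun z hz => ?_⟩
  · by_cases h : f + g = 0
    · simp [h]
    by_cases hg0 : g = 0
    · simpa [hg0] using hf.1
    exact (RatFunc.intDegree_add_le hg0 h).trans (max_le hf.1 hg.1)
  · obtain ⟨r, hr⟩ := RatFunc.denom_add_dvd f g
    have h0 : aeval z f.denom * aeval z g.denom = 0 := by
      rw [← map_mul, hr, map_mul, hz, zero_mul]
    exact (mul_eq_zero.1 h0).elim (hf.2 z) (hg.2 z)

theorem IsStableProper.mul {f g : RatFunc ℝ} (hf : IsStableProper f) (hg : IsStableProper g) :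
    IsStableProper (f * g) := by
  refine ⟨?_, fun z hz => ?_⟩
  · by_cases hf0 : f = 0
    · simp [hf0]
    by_cases hg0 : g = 0
    · simp [hg0]
    rw [RatFunc.intDegree_mul hf0 hg0]
    exact add_nonpos hf.1 hg.1
  · obtain ⟨r, hr⟩ := RatFunc.denom_mul_dvd f g
    have h0 : aeval z f.denom * aeval z g.denom = 0 := by
      rw [← map_mul, hr, map_mul, hz, zero_mul]
    exact (mul_eq_zero.1 h0).elim (hf.2 z) (hg.2 z)

theorem isStableProper_C (a : ℝ) : IsStableProper (RatFunc.C a) :=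
  isStableProper_of_mul_eq (p := C a) (q := 1) (by simp) (by simp) (by simp)

/-- The ring of proper stable real rational transfer functions. -/
def stableProper : Subring (RatFunc ℝ) where
  carrier := {f | IsStableProper f}
  mul_mem' := IsStableProper.mul
  one_mem' := by simpa using isStableProper_C 1
  add_mem' := IsStableProper.add
  zero_mem' := by simpa using isStableProper_C 0
  neg_mem' := fun {f} hf => by simpa using (isStableProper_C (-1)).mul hf

/-- Solving for unit injections yields the columns of a right inverse of `1 - M`, which is the
inverse for a square matrix over a field. -/
theorem internallyStable_of_solvable {n : ℕ} {M : Matrix (Fin n) (Fin n) (RatFunc ℝ)}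
    (h : ∀ d : Fin n → RatFunc ℝ, (∀ i, d i ∈ stableProper) →
      ∃ w : Fin n → RatFunc ℝ, (∀ i, w i ∈ stableProper) ∧ w = M.mulVec w + d) :
    InternallyStable M := by
  have hcol : ∀ j : Fin n, ∃ w : Fin n → RatFunc ℝ, (∀ i, w i ∈ stableProper) ∧
      w = M.mulVec w + Pi.single j 1 := fun j => h _ fun i => by
    by_cases hij : i = j
    · subst hij
      simp
    · simp [Pi.single_eq_of_ne hij]
  choose w hw hw' using hcol
  have hinv : (1 - M) * (Matrix.of fun i j => w j i) = 1 := by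
    rw [sub_mul, one_mul, sub_eq_iff_eq_add]
    ext i j
    have := congrFun (hw' j) i
    simp only [Matrix.of_apply, Matrix.add_apply, Matrix.mul_apply, Matrix.one_apply]
    rw [this, Pi.add_apply, add_comm, Matrix.mulVec, dotProduct, Pi.single_apply]
  refine ⟨IsUnit.of_mul_eq_one _ hinv, fun i j => ?_⟩
  rw [Matrix.inv_eq_right_inv hinv]
  exact hw j i

/-! ### The small gain theorem. -/

theorem norm_eval_le_of_imaginary_axis {n d : ℂ[X]} {c : ℝ} (hc : 0 ≤ c)
    (hdeg : n.degree ≤ d.degree) (hd : ∀ z : ℂ, 0 ≤ z.re → d.eval z ≠ 0)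
    (h : ∀ ω : ℝ, ‖n.eval (ω * Complex.I)‖ ≤ c * ‖d.eval (ω * Complex.I)‖)
    {z : ℂ} (hz : 0 ≤ z.re) : ‖n.eval z‖ ≤ c * ‖d.eval z‖ := by
  have hO : (fun z => n.eval z / d.eval z) =O[Bornology.cobounded ℂ] fun _ => (1 : ℝ) := by
    obtain ⟨B, hB⟩ := (isBigO_cobounded_of_degree_le hdeg).bound
    refine IsBigO.of_bound (max B 0) (hB.mono fun x hx => ?_)
    rw [norm_div, norm_one, mul_one]
    refine div_le_of_le_mul₀ (norm_nonneg _) (le_max_right _ _) (hx.trans ?_)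
    gcongr
    exact le_max_left _ _
  have hcl : closure {z : ℂ | 0 < z.re} = {z : ℂ | 0 ≤ z.re} := by simp
  have key : ‖n.eval z / d.eval z‖ ≤ c := by
    -- The quotient is bounded at infinity by the degree bound, so growth exponent 1 with
    -- coefficient 0 suffices.
    refine PhragmenLindelof.right_half_plane_of_bounded_on_real
      (f := fun z => n.eval z / d.eval z) ?_ ⟨1, by norm_num, 0, ?_⟩ ?_ ?_ hz
    · refine DifferentiableOn.diffContOnCl fun x hx => ?_
      rw [hcl] at hx
      exact (n.differentiable.differentiableAt.div d.differentiable.differentiableAt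
        (hd x hx)).differentiableWithinAt
    · simpa using hO.mono inf_le_left
    · exact (isBigO_one_iff ℝ).1 (hO.comp_tendsto (RCLike.tendsto_ofReal_atTop_cobounded ℂ))
    · intro x
      rw [norm_div]
      exact div_le_of_le_mul₀ (norm_nonneg _) hc (h x)
  rw [norm_div, div_le_iff₀ (norm_pos_iff.2 (hd z hz))] at key
  exact key

/-- A drop in degree would give `d + n = o(d)` along the positive reals, against `‖d + n‖ ≥ (1 - c)
‖d‖`. -/
theorem degree_le_degree_add_of_norm_eval_le {n d : ℂ[X]} {c : ℝ} (hc : c < 1)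
    (hd : ∀ z : ℂ, 0 ≤ z.re → d.eval z ≠ 0)
    (h : ∀ z : ℂ, 0 ≤ z.re → ‖n.eval z‖ ≤ c * ‖d.eval z‖) : d.degree ≤ (d + n).degree := by
  by_contra! hlt
  have ho := (isLittleO_cobounded_of_degree_lt hlt).comp_tendsto
    (RCLike.tendsto_ofReal_atTop_cobounded ℂ)
  obtain ⟨x, hx, hx0⟩ :=
    ((ho.bound (c := (1 - c) / 2) (by linarith)).and (eventually_ge_atTop 0)).exists
  have hre : 0 ≤ ((x : ℝ) : ℂ).re := by simpa using hx0
  have hpos := norm_pos_iff.2 (hd _ hre)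
  have h1 : ‖((d + n).eval (x : ℂ))‖ ≤ (1 - c) / 2 * ‖d.eval (x : ℂ)‖ := hx
  have h2 := h _ hre
  have h3 : ‖d.eval (x : ℂ)‖ ≤ ‖(d + n).eval (x : ℂ)‖ + ‖n.eval (x : ℂ)‖ := by
    simpa using norm_sub_le ((d + n).eval (x : ℂ)) (n.eval (x : ℂ))
  nlinarith

theorem freqResp_eq (f : RatFunc ℝ) (ω : ℝ) :
    freqResp f ω = aeval (ω * Complex.I) f.num / aeval (ω * Complex.I) f.denom := by
  rw [freqResp, RatFunc.eval, mul_comm, aeval_def, aeval_def]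

theorem finite_setOf_aeval_imaginary_eq_zero {p : ℝ[X]} (hp : p ≠ 0) :
    {ω : ℝ | aeval (ω * Complex.I) p = 0}.Finite := by
  have hfin : {z : ℂ | aeval z p = 0}.Finite := by
    refine (p.rootSet_finite ℂ).subset fun z hz => ?_
    exact (mem_rootSet).2 ⟨hp, hz⟩
  refine hfin.preimage (f := fun ω : ℝ => (ω * Complex.I : ℂ)) fun a _ b _ hab => ?_
  simpa using hab

/-- With `f = n / d`, the bound `‖n‖ ≤ c ‖d‖` spreads from the axis to the closed right half-plane.
So `d + n` has no zero there and keeps the degree of `d`, and `(1 + f)⁻¹ = d / (d + n)`. -/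
theorem small_gain {f : RatFunc ℝ} (hf : f ∈ stableProper) {c : ℝ} (hc0 : 0 ≤ c) (hc : c < 1)
    {s : Set ℝ} (hs : s.Finite) (h : ∀ ω ∉ s, ‖freqResp f ω‖ ≤ c) :
    1 + f ≠ 0 ∧ (1 + f)⁻¹ ∈ stableProper := by
  set n := f.num
  set d := f.denom
  have hd : ∀ z : ℂ, 0 ≤ z.re → (d.map (algebraMap ℝ ℂ)).eval z ≠ 0 := fun z hz h0 => by
    rw [eval_map_algebraMap] at h0
    exact (hf.2 z h0).not_ge hz
  have him : ∀ ω : ℝ, ‖(n.map (algebraMap ℝ ℂ)).eval (ω * Complex.I)‖ ≤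
      c * ‖(d.map (algebraMap ℝ ℂ)).eval (ω * Complex.I)‖ := by
    have hclosed : IsClosed {ω : ℝ | ‖(n.map (algebraMap ℝ ℂ)).eval (ω * Complex.I)‖ ≤
        c * ‖(d.map (algebraMap ℝ ℂ)).eval (ω * Complex.I)‖} := by
      refine isClosed_le ?_ ?_ <;> fun_prop
    -- The polynomial inequality is a closed condition, so it extends across the finite exceptional
    -- set.
    have hdense : Dense sᶜ := hs.countable.dense_compl ℝ
    intro ω
    refine hclosed.closure_subset_iff.2 (fun x hx => ?_) (hdense ω)
    have hx' := h x hx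
    have hpos := norm_pos_iff.2 (hd (x * Complex.I) (by simp))
    rw [freqResp_eq, norm_div, ← eval_map_algebraMap, ← eval_map_algebraMap,
      div_le_iff₀ hpos] at hx'
    exact hx'
  have hdeg : (n.map (algebraMap ℝ ℂ)).degree ≤ (d.map (algebraMap ℝ ℂ)).degree := by
    rw [degree_map, degree_map]
    exact degree_le_of_natDegree_le (IsStableProper.natDegree_num_le hf) |>.trans
      (degree_eq_natDegree f.denom_ne_zero).ge
  have hle := fun z hz => norm_eval_le_of_imaginary_axis (z := z) hc0 hdeg hd him hz
  have hdeg' := degree_le_degree_add_of_norm_eval_le hc hd hle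
  rw [← Polynomial.map_add, degree_map, degree_map] at hdeg'
  have hne : ∀ z : ℂ, 0 ≤ z.re → aeval z (d + n) ≠ 0 := fun z hz h0 => by
    have h1 := hle z hz
    have hpos := norm_pos_iff.2 (hd z hz)
    rw [eval_map_algebraMap] at h1 hpos
    rw [eval_map_algebraMap] at h1
    rw [map_add, add_comm, add_eq_zero_iff_eq_neg] at h0
    rw [h0, norm_neg] at h1
    nlinarith
  have hdn : d + n ≠ 0 := fun h0 => hne 0 le_rfl (by simp [h0])
  have hd0 : algebraMap ℝ[X] (RatFunc ℝ) d ≠ 0 := by simpa using f.denom_ne_zero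
  have hmul : (1 + f) * algebraMap ℝ[X] (RatFunc ℝ) d = algebraMap ℝ[X] (RatFunc ℝ) (d + n) := by
    nth_rw 1 [← f.num_div_denom]
    rw [add_mul, div_mul_cancel₀ _ hd0, one_mul, map_add]
  have h1f : 1 + f ≠ 0 := fun h0 => by
    rw [h0, zero_mul, eq_comm] at hmul
    exact hdn ((map_eq_zero_iff _ (RatFunc.algebraMap_injective ℝ)).1 hmul)
  refine ⟨h1f, isStableProper_of_mul_eq (p := d) (q := d + n) ?_
    (fun z hz => lt_of_not_ge fun hz' => hne z hz' hz) (natDegree_le_natDegree hdeg')⟩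
  rw [← hmul, inv_mul_cancel_left₀ h1f]

theorem small_gain_mul {f g h : RatFunc ℝ} (hfgh : h = f * g) (hh : h ∈ stableProper)
    (hf : hinfNorm f < 1) (hg : hinfNorm g < 1) :
    1 + h ≠ 0 ∧ (1 + h)⁻¹ ∈ stableProper := by
  have hle : ∀ k : RatFunc ℝ, hinfNorm k < 1 → ∀ ω, ‖freqResp k ω‖ ≤ (hinfNorm k).toReal := by
    intro k hk ω
    rw [← toReal_enorm]
    exact ENNReal.toReal_mono (hk.trans ENNReal.one_lt_top).ne
      (le_iSup (fun ω => ‖freqResp k ω‖ₑ) ω)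
  have hlt : ∀ k : RatFunc ℝ, hinfNorm k < 1 → (hinfNorm k).toReal < 1 := fun k hk => by
    simpa using ENNReal.toReal_strict_mono ENNReal.one_ne_top hk
  -- Evaluation is multiplicative only away from the poles of the factors, which may lie on the
  -- axis; those finitely many frequencies are excluded.
  refine small_gain hh ENNReal.toReal_nonneg (hlt f hf)
    ((finite_setOf_aeval_imaginary_eq_zero f.denom_ne_zero).union
      (finite_setOf_aeval_imaginary_eq_zero g.denom_ne_zero)) fun ω hω => ?_
  simp only [Set.mem_union, Set.mem_ofPred_eq, not_or, aeval_def] at hω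
  have hmul : freqResp h ω = freqResp f ω * freqResp g ω := by
    rw [hfgh, freqResp, freqResp, freqResp, mul_comm Complex.I]
    exact RatFunc.eval_mul _ _ hω.1 hω.2
  rw [hmul, norm_mul]
  exact (mul_le_of_le_one_right (norm_nonneg _) ((hle g hg ω).trans (hlt g hg).le)).trans
    (hle f hf ω)

/-! ### Stability of the plant blocks and of the compensator. -/

theorem re_neg_of_quadratic {a b c : ℝ} (ha : 0 < a) (hb : 0 < b) (hc : 0 < c) (z : ℂ)
    (hz : (a : ℂ) * z ^ 2 + b * z + c = 0) : z.re < 0 := by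
  by_contra! hre
  have h1 := congrArg Complex.re hz
  have h2 := congrArg Complex.im hz
  simp [pow_two] at h1 h2
  have h3 : z.im * (2 * a * z.re + b) = 0 := by linarith
  have h4 : 0 < 2 * a * z.re + b := by positivity
  have h5 : z.im = 0 := (mul_eq_zero.1 h3).resolve_right h4.ne'
  rw [h5] at h1
  have : 0 < a * (z.re * z.re) + b * z.re + c := by positivity
  linarith

theorem re_neg_of_linear {a b : ℝ} (ha : 0 < a) (hb : 0 < b) (z : ℂ)
    (hz : (a : ℂ) * z + b = 0) : z.re < 0 := by
  have h1 := congrArg Complex.re hz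
  simp at h1
  by_contra! hre
  have : 0 ≤ a * z.re := by positivity
  linarith

namespace Params

variable (p : Params)

theorem Ri'_pos : 0 < p.Ri' := add_pos p.Ri_pos p.Ron_pos

theorem α₀_pos : 0 < p.α₀ :=
  mul_pos (mul_pos p.Cap_pos p.L_pos) (add_pos p.RL_pos p.Rc_pos)

theorem α₁_pos : 0 < p.α₁ := by
  have := p.Ri'_pos
  have := p.RL_pos
  have := p.Rc_pos
  have := p.Cap_pos
  have := p.L_pos
  unfold α₁
  positivity

theorem α₂_pos : 0 < p.α₂ := add_pos p.RL_pos p.Ri'_pos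

/-- The polynomial `α₀ s² + α₁ s + α₂`. -/
noncomputable def denPoly : ℝ[X] := C p.α₀ * X ^ 2 + C p.α₁ * X + C p.α₂

theorem algebraMap_denPoly : algebraMap ℝ[X] (RatFunc ℝ) p.denPoly = p.den := by
  simp [denPoly, den]

theorem natDegree_denPoly : p.denPoly.natDegree = 2 := natDegree_quadratic p.α₀_pos.ne'

theorem den_ne_zero : p.den ≠ 0 := by
  rw [← algebraMap_denPoly, Ne, map_eq_zero_iff _ (RatFunc.algebraMap_injective ℝ)]
  intro h
  simpa [h] using p.natDegree_denPoly

theorem div_den_mem_stableProper {q : ℝ[X]} (hq : q.natDegree ≤ 2) :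
    algebraMap ℝ[X] (RatFunc ℝ) q / p.den ∈ stableProper := by
  refine isStableProper_of_mul_eq (p := q) (q := p.denPoly) ?_ (fun z hz => ?_)
    (hq.trans_eq p.natDegree_denPoly.symm)
  · rw [algebraMap_denPoly, div_mul_cancel₀ _ p.den_ne_zero]
  · exact re_neg_of_quadratic p.α₀_pos p.α₁_pos p.α₂_pos z (by simpa [denPoly] using hz)

theorem P11_mem : p.P11 ∈ stableProper := by
  have h : (C p.RL * (1 + C (p.Cap * p.Rc) * X)).natDegree ≤ 2 := by compute_degree!
  simpa [P11] using p.div_den_mem_stableProper h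

theorem P12_mem : p.P12 ∈ stableProper := by
  have h : (C p.RL * (-(C (p.Cap * p.L * p.Rc) * X ^ 2)
      - C (p.L + p.Cap * p.Rc * p.Ri') * X - C p.Ri')).natDegree ≤ 2 := by compute_degree
  simpa [P12] using p.div_den_mem_stableProper h

theorem P21_mem : p.P21 ∈ stableProper := by
  have h : (C (p.Cap * (p.RL + p.Rc)) * X + C 1 : ℝ[X]).natDegree ≤ 2 :=
    natDegree_linear_le.trans (by norm_num)
  simpa [P21] using p.div_den_mem_stableProper h

theorem k_mem : p.k ∈ stableProper := isStableProper_C _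

theorem C_mul_X_add_C_ne_zero {a b : ℝ} (ha : a ≠ 0) :
    (RatFunc.C a * RatFunc.X + RatFunc.C b : RatFunc ℝ) ≠ 0 := by
  have h : algebraMap ℝ[X] (RatFunc ℝ) (C a * X + C b) ≠ 0 := by
    rw [Ne, map_eq_zero_iff _ (RatFunc.algebraMap_injective ℝ)]
    intro h
    have := natDegree_linear (b := b) ha
    simp [h] at this
  simpa using h

theorem linear_div_linear_mem {a b c d : ℝ} (hc : 0 < c) (hd : 0 < d) :
    (RatFunc.C a * RatFunc.X + RatFunc.C b) / (RatFunc.C c * RatFunc.X + RatFunc.C d)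
      ∈ stableProper := by
  refine isStableProper_of_mul_eq (p := C a * X + C b) (q := C c * X + C d) ?_ (fun z hz => ?_) ?_
  · simpa using div_mul_cancel₀ _ (C_mul_X_add_C_ne_zero (b := d) hc.ne')
  · exact re_neg_of_linear hc hd z (by simpa using hz)
  · rw [natDegree_linear hc.ne']
    exact natDegree_linear_le

theorem one_add_C_mul_X_ne_zero {a : ℝ} (ha : a ≠ 0) :
    (1 + RatFunc.C a * RatFunc.X : RatFunc ℝ) ≠ 0 := by
  have := C_mul_X_add_C_ne_zero (b := 1) ha
  rwa [map_one, add_comm] at this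

theorem C_RL_ne_zero : (RatFunc.C p.RL : RatFunc ℝ) ≠ 0 :=
  (_root_.map_ne_zero _).2 p.RL_pos.ne'

theorem P11_ne_zero : p.P11 ≠ 0 :=
  div_ne_zero (mul_ne_zero p.C_RL_ne_zero
    (one_add_C_mul_X_ne_zero (mul_pos p.Cap_pos p.Rc_pos).ne')) p.den_ne_zero

/-- The common denominator cancels, leaving as only pole the zero of `P11` at `-1 / (Cap * Rc)`. -/
theorem G1_mem : p.G1 ∈ stableProper := by
  have h := linear_div_linear_mem (a := p.Cap * (p.RL + p.Rc)) (b := 1)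
    (mul_pos p.RL_pos (mul_pos p.Cap_pos p.Rc_pos)) p.RL_pos
  convert h using 1
  rw [G1, P21, P11, div_div_div_cancel_right₀ p.den_ne_zero]
  simp only [map_one, map_mul, map_add]
  congr 1
  ring

theorem G1_mul_P11 : p.G1 * p.P11 = p.P21 := div_mul_cancel₀ _ p.P11_ne_zero

theorem G2_eq : p.G2 = -(RatFunc.C p.L * RatFunc.X + RatFunc.C p.Ri') := by
  rw [G2, div_eq_iff p.P11_ne_zero, P11, P12, ← mul_div_assoc]
  congr 1
  simp only [map_mul, map_add]
  ring

/-- `G2` is an improper polynomial of degree one; the low-pass factor restores properness. -/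
theorem compensator_mem {pH : ℝ} (hpH : 0 < pH) : p.compensator pH ∈ stableProper := by
  have h := linear_div_linear_mem (a := p.L) (b := p.Ri') (mul_pos p.kFF_pos (inv_pos.2 hpH))
    p.kFF_pos
  convert h using 1
  rw [compensator, G2_eq, neg_neg, k]
  simp only [map_mul, map_inv₀]
  congr 1
  ring

end Params

/-! ### From the outer loop to the loop with the LEC. -/

/-- `K` and `Gf` may be unstable on their own; these products with the sensitivity are, up to sign,
entries of the stable inverse matrix. -/
theorem outerLoop_transfer {p : Params} {K Gf : RatFunc ℝ}
    (h : InternallyStable (outerLoop p K Gf)) :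
    1 + p.P11 * p.k * K * Gf ≠ 0 ∧
      sensitivity p K Gf ∈ stableProper ∧
      sensitivity p K Gf * (p.P11 * p.k) ∈ stableProper ∧
      sensitivity p K Gf * (p.P11 * p.k) * K ∈ stableProper ∧
      K * Gf * sensitivity p K Gf ∈ stableProper ∧
      K * sensitivity p K Gf ∈ stableProper ∧
      Gf * sensitivity p K Gf ∈ stableProper := by
  obtain ⟨hu, hN⟩ := h
  have hmul := Matrix.mul_nonsing_inv (1 - outerLoop p K Gf)
    ((Matrix.isUnit_iff_isUnit_det _).1 hu)
  set N := (1 - outerLoop p K Gf)⁻¹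
  rw [sub_mul, one_mul] at hmul
  have e : ∀ i j, N i j - (outerLoop p K Gf * N) i j = (1 : Matrix (Fin 3) (Fin 3) _) i j :=
    fun i j => congrFun (congrFun hmul i) j
  simp only [Matrix.mul_apply, Fin.sum_univ_three, outerLoop] at e
  have e0 := fun j => e 0 j
  have e1 := fun j => e 1 j
  have e2 := fun j => e 2 j
  simp at e0 e1 e2
  have hne : N 0 0 * (1 + p.P11 * p.k * K * Gf) = 1 := by
    have a := e0 0; have b := e1 0; have c := e2 0
    simp at a b c
    linear_combination a + p.P11 * p.k * b + p.P11 * p.k * K * c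
  have hD : 1 + p.P11 * p.k * K * Gf ≠ 0 := right_ne_zero_of_mul_eq_one hne
  have hS : sensitivity p K Gf = N 0 0 := (eq_inv_of_mul_eq_one_left hne).symm
  have h01 : N 0 1 = N 0 0 * (p.P11 * p.k) := by
    refine mul_right_cancel₀ hD ?_
    have a := e0 1; have b := e1 1; have c := e2 1
    simp at a b c
    linear_combination a + p.P11 * p.k * b + p.P11 * p.k * K * c - p.P11 * p.k * hne
  have h02 : N 0 2 = N 0 0 * (p.P11 * p.k) * K := by
    refine mul_right_cancel₀ hD ?_
    have a := e0 2; have b := e1 2; have c := e2 2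
    simp at a b c
    linear_combination a + p.P11 * p.k * b + p.P11 * p.k * K * c - p.P11 * p.k * K * hne
  have h20 : Gf * N 0 0 = -N 2 0 := by
    have c := e2 0
    simp at c
    linear_combination c
  have h10 : K * Gf * N 0 0 = -N 1 0 := by
    have b := e1 0; have c := e2 0
    simp at b c
    linear_combination b + K * c
  have h22 : N 2 2 = N 0 0 := by
    have c := e2 2
    simp at c
    rw [h02] at c
    linear_combination c - hne
  have h12 : K * N 0 0 = N 1 2 := by
    have b := e1 2
    simp at b
    rw [h22] at b
    linear_combination -b
  rw [hS, ← h02, ← h01, h10, h12, h20]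
  exact ⟨hD, hN 0 0, hN 0 1, hN 0 2, stableProper.neg_mem (hN 1 0), hN 1 2,
    stableProper.neg_mem (hN 2 0)⟩

theorem lecLoop_internallyStable {pnom p : Params} {pH : ℝ} (hpH : 0 < pH) {K Gf : RatFunc ℝ}
    (hK : InternallyStable (outerLoop p K Gf))
    (hQ0 : 1 - sensitivity p K Gf * (p.P11 * p.k) *
      (pnom.compensator pH * (p.G1 - pnom.G1)) ≠ 0)
    (hQ : (1 - sensitivity p K Gf * (p.P11 * p.k) *
      (pnom.compensator pH * (p.G1 - pnom.G1)))⁻¹ ∈ stableProper) :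
    InternallyStable (lecLoop pnom pH p K Gf) := by
  obtain ⟨hD, hS, hSP, hSPK, hKGS, hKS, hGS⟩ := outerLoop_transfer hK
  have hF := pnom.compensator_mem hpH
  have hG := p.G1_mem
  have hG' := pnom.G1_mem
  have hk := p.k_mem
  have hP11 := p.P11_mem
  have hP12 := p.P12_mem
  have hP21 := p.P21_mem
  have hSeq : sensitivity p K Gf * (1 + p.P11 * p.k * K * Gf) = 1 := inv_mul_cancel₀ hD
  have hQeq := mul_inv_cancel₀ hQ0
  have hGP := p.G1_mul_P11
  refine internallyStable_of_solvable fun d hd => ?_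
  have hd0 := hd 0
  have hd1 := hd 1
  have hd2 := hd 2
  have hd3 := hd 3
  have hd4 := hd 4
  have hd5 := hd 5
  have hd6 := hd 6
  have hd7 := hd 7
  unfold lecLoop Params.P22
  generalize sensitivity p K Gf = S at *
  generalize pnom.compensator pH = F at *
  generalize p.G1 = G at *
  generalize pnom.G1 = G' at *
  generalize p.k = k at *
  generalize p.P11 = P at *
  generalize p.P12 = P' at *
  generalize p.P21 = P'' at *
  generalize (1 - S * (P * k) * (F * (G - G')))⁻¹ = Q at *
  -- `A` gathers the injections that reach `v_o` without passing through `K`, using `P'' * vs = G *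
  -- (vo - P' * d 0 - d 2)`. Only `d 7` enters through `K`.
  obtain ⟨A, hA⟩ : ∃ A, A = P' * d 0 + P * d 1 + d 2
    + P * k * (F * ((P - G * P') * d 0 - G * d 2 + d 3 + d 4) + d 5) + P * k * d 6 := ⟨_, rfl⟩
  obtain ⟨vo, hvo⟩ : ∃ vo, vo = Q * (S * A + S * (P * k) * K * d 7) := ⟨_, rfl⟩
  -- `e` and `vc` are rewritten by `S * P * k * K * Gf = 1 - S` and the definition of `Q`, so that
  -- `K` and `Gf` occur only inside stable products.
  obtain ⟨e, he⟩ : ∃ e, e = -(Q * (Gf * S) * A) - Q * (1 - S) * d 7 + d 7 := ⟨_, rfl⟩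
  obtain ⟨vc, hvc⟩ : ∃ vc, vc = -(Q * (K * Gf * S) * A)
    + Q * (K * S) * (1 - P * k * (F * (G - G'))) * d 7 + d 6 := ⟨_, rfl⟩
  obtain ⟨vi, hvi⟩ : ∃ vi, vi = F * (G - G') * vo
    + F * ((P - G * P') * d 0 - G * d 2 + d 3 + d 4) + d 5 := ⟨_, rfl⟩
  obtain ⟨vs, hvs⟩ : ∃ vs, vs = k * (vi + vc) + d 1 := ⟨_, rfl⟩
  obtain ⟨iL, hiL⟩ : ∃ iL, iL = P * d 0 + P'' * vs + d 3 := ⟨_, rfl⟩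
  obtain ⟨ie, hie⟩ : ∃ ie, ie = -G' * vo + iL + d 4 := ⟨_, rfl⟩
  have mA : A ∈ stableProper := by
    rw [hA]
    repeat' with_reducible first
      | assumption | apply one_mem | apply add_mem | apply sub_mem | apply neg_mem
      | apply mul_mem
  have mvo : vo ∈ stableProper := by
    rw [hvo]
    repeat' with_reducible first
      | assumption | apply one_mem | apply add_mem | apply sub_mem | apply neg_mem
      | apply mul_mem
  have me : e ∈ stableProper := by
    rw [he]
    repeat' with_reducible first
      | assumption | apply one_mem | apply add_mem | apply sub_mem | apply neg_mem
      | apply mul_mem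
  have mvc : vc ∈ stableProper := by
    rw [hvc]
    repeat' with_reducible first
      | assumption | apply one_mem | apply add_mem | apply sub_mem | apply neg_mem
      | apply mul_mem
  have mvi : vi ∈ stableProper := by
    rw [hvi]
    repeat' with_reducible first
      | assumption | apply one_mem | apply add_mem | apply sub_mem | apply neg_mem
      | apply mul_mem
  have mvs : vs ∈ stableProper := by
    rw [hvs]
    repeat' with_reducible first
      | assumption | apply one_mem | apply add_mem | apply sub_mem | apply neg_mem
      | apply mul_mem
  have miL : iL ∈ stableProper := by
    rw [hiL]
    repeat' with_reducible first
      | assumption | apply one_mem | apply add_mem | apply sub_mem | apply neg_mem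
      | apply mul_mem
  have mie : ie ∈ stableProper := by
    rw [hie]
    repeat' with_reducible first
      | assumption | apply one_mem | apply add_mem | apply sub_mem | apply neg_mem
      | apply mul_mem
  have ee : e = -Gf * vo + d 7 := by
    linear_combination he + Gf * hvo + Q * d 7 * hSeq
  have evc : vc = K * e + d 6 := by
    linear_combination hvc - K * he + K * d 7 * hQeq
  have evo : vo = P' * d 0 + P * vs + d 2 := by
    -- After multiplication by `S`, the terms in `vo` collapse through `S * (1 + P * k * K * Gf) =
    -- 1`.
    refine mul_left_cancel₀ (left_ne_zero_of_mul_eq_one hSeq : S ≠ 0) ?_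
    linear_combination vo * hSeq + (1 - S * (P * k) * (F * (G - G'))) * hvo
      + (S * A + S * (P * k) * K * d 7) * hQeq + S * hA - S * P * hvs - S * P * k * hvi
      - S * P * k * evc - S * P * k * K * ee
  have evi : vi = F * ie + d 5 := by
    linear_combination hvi - F * hie - F * hiL + F * G * evo + F * vs * hGP
  refine ⟨![d 0, vs, vo, iL, ie, vi, vc, e], ?_, ?_⟩
  · intro i
    fin_cases i <;> assumption
  · ext i
    fin_cases i <;> simp
    · linear_combination hvs
    · linear_combination evo
    · linear_combination hiL
    · linear_combination hie
    · linear_combination evi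
    · linear_combination evc
    · linear_combination ee

theorem Wr_eq_neg_compensator_mul (pnom : Params) (pH : ℝ) (Λ : RatFunc ℝ) :
    Wr pnom pH Λ = -(pnom.compensator pH * Λ) := by
  rw [Wr, Params.compensator, neg_div, neg_mul, neg_neg]

end BuckLEC

theorem theorem2 (U : Set BuckLEC.Params) (pnom : BuckLEC.Params) (pH : ℝ) (hpH : 0 < pH)
    (K Gf Λ : RatFunc ℝ)
    (hΛ : BuckLEC.IsUncertaintyWeight U pnom Λ)
    (hK : BuckLEC.RobustlyStabilizes U K Gf)
    (hS : ∀ p ∈ U, BuckLEC.hinfNorm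
      (BuckLEC.sensitivity p K Gf * p.P11 * p.k * BuckLEC.Wr pnom pH Λ) < 1) :
    BuckLEC.RobustlyStableWithLEC U pnom pH K Gf := by
  intro p hp
  obtain ⟨Δ, hΔ, hΔ1⟩ := hΛ p hp
  obtain ⟨-, -, hSP, -⟩ := BuckLEC.outerLoop_transfer (hK p hp)
  -- Stability is read off from `G1 - Ĝ1`; the factorization through `Λ` and `Δ` serves only for the
  -- gain bound.
  have hmem : BuckLEC.sensitivity p K Gf * (p.P11 * p.k) *
      (pnom.compensator pH * (p.G1 - pnom.G1)) ∈ BuckLEC.stableProper :=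
    mul_mem hSP (mul_mem (pnom.compensator_mem hpH) (sub_mem p.G1_mem pnom.G1_mem))
  have hprod : -(BuckLEC.sensitivity p K Gf * (p.P11 * p.k) *
      (pnom.compensator pH * (p.G1 - pnom.G1))) =
      BuckLEC.sensitivity p K Gf * p.P11 * p.k * BuckLEC.Wr pnom pH Λ * Δ := by
    rw [BuckLEC.Wr_eq_neg_compensator_mul, hΔ]
    ring
  have hgain := BuckLEC.small_gain_mul hprod (neg_mem hmem) (hS p hp) hΔ1
  rw [← sub_eq_add_neg] at hgain
  exact BuckLEC.lecLoop_internallyStable hpH (hK p hp) hgain.1 hgain.2
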